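/- Let $\alpha,\beta,\mu\in\mathbb{R}\setminus\{0\}$ with $\Delta:=\alpha^2+\beta^2-2\mu^2>0$ and let $x_1,x_2\in\mathbb{R}$. Put $y_1=x+(\alpha^2-3\beta^2)t+x_1$, $y_2=x+(3\alpha^2-\beta^2)t+x_2$, $$G(t,x)=\frac{\beta\sqrt{\alpha^2+\beta^2}}{\alpha\sqrt{\Delta}}\sin(\alpha y_1)-\frac{\sqrt2\,\mu\beta\,[\cosh(\beta y_2)+\sinh(\beta y_2)]}{\Delta},$$ $$F(t,x)=\cosh(\beta y_2)-\frac{\sqrt2\,\mu\beta\,[\alpha\cos(\alpha y_1)-\beta\sin(\alpha y_1)]}{\alpha\sqrt{\alpha^2+\beta^2}\,\sqrt{\Delta}},$$ and let $B_\mu=B_{\alpha,\beta,\mu}$ be the Gardner breather $$B_\mu(t,x)=2\sqrt2\,\partial_x\Big[\arctan\Big(\frac{G(t,x)}{F(t,x)}\Big)\Big],$$ where at points with $F(t,x)=0$ the angle is taken modulo $\pi$, i.e. the derivative of $\arctan(G/F)$ is replaced by that of $-\arctan(F/G)$. Then for every fixed $t\in\mathbb{R}$ one has $F(t,x)^2+G(t,x)^2>0$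 for all $x\in\mathbb{R}$, the function $x\mapsto B_\mu(t,x)$ is $C^\infty$ on $\mathbb{R}$, and it satisfies, for all $x\in\mathbb{R}$, the nonlinear stationary equation $$\begin{aligned}J_\mu[B_\mu]:={}&B_{\mu,xxxx}-2(\beta^2-\alpha^2)\big(B_{\mu,xx}+3\mu B_\mu^2+B_\mu^3\big)+(\alpha^2+\beta^2)^2B_\mu+5B_\mu B_{\mu,x}^2+5B_\mu^2B_{\mu,xx}\\&+\tfrac32B_\mu^5+5\mu B_{\mu,x}^2+10\mu B_\mu B_{\mu,xx}+10\mu^2B_\mu^3+\tfrac{15}{2}\mu B_\mu^4=0.\end{aligned}$$ -/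

import Mathlib

noncomputable section

/-- `Δ = α² + β² - 2μ²`. -/
def gardnerDelta (α β μ : ℝ) : ℝ := α ^ 2 + β ^ 2 - 2 * μ ^ 2

/-- `y₁ = x + δ t + x₁` with `δ = α² - 3β²`. -/
def gardnerY1 (α β x₁ t x : ℝ) : ℝ := x + (α ^ 2 - 3 * β ^ 2) * t + x₁

/-- `y₂ = x + γ t + x₂` with `γ = 3α² - β²`. -/
def gardnerY2 (α β x₂ t x : ℝ) : ℝ := x + (3 * α ^ 2 - β ^ 2) * t + x₂

/-- The function `G_{α,β,μ}(t,x)`. -/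
def gardnerG (α β μ x₁ x₂ t x : ℝ) : ℝ :=
  β * √(α ^ 2 + β ^ 2) / (α * √(gardnerDelta α β μ)) * Real.sin (α * gardnerY1 α β x₁ t x)
    - √2 * μ * β * (Real.cosh (β * gardnerY2 α β x₂ t x) + Real.sinh (β * gardnerY2 α β x₂ t x))
        / gardnerDelta α β μ

/-- The function `F_{α,β,μ}(t,x)`. -/
def gardnerF (α β μ x₁ x₂ t x : ℝ) : ℝ :=
  Real.cosh (β * gardnerY2 α β x₂ t x)
    - √2 * μ * β * (α * Real.cos (α * gardnerY1 α β x₁ t x)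
          - β * Real.sin (α * gardnerY1 α β x₁ t x))
        / (α * √(α ^ 2 + β ^ 2) * √(gardnerDelta α β μ))

open Classical in
/-- The Gardner breather `B_μ(t,x) = 2√2 ∂ₓ [arctan (G/F)]`. For some parameters `F` has zeros,
where the angle `arctan (G/F)` is a continuous function only modulo `π`; at such a point its
derivative is that of the branch `-arctan (F/G)`, which agrees with `arctan (G/F)` modulo a constant
on each side (by `arctan r + arctan (1/r) = ± π/2`) and is smooth there, as `G ≠ 0` where `F = 0`. -/
def gardnerBreather (α β μ x₁ x₂ t x : ℝ) : ℝ :=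
  if gardnerF α β μ x₁ x₂ t x ≠ 0 then
    2 * √2 * deriv (fun s : ℝ =>
      Real.arctan (gardnerG α β μ x₁ x₂ t s / gardnerF α β μ x₁ x₂ t s)) x
  else
    2 * √2 * deriv (fun s : ℝ =>
      -Real.arctan (gardnerF α β μ x₁ x₂ t s / gardnerG α β μ x₁ x₂ t s)) x

/-- The nonlinear fourth-order operator `J_μ[b]`, for a function `b` of the space variable. -/
def gardnerJ (α β μ : ℝ) (b : ℝ → ℝ) (x : ℝ) : ℝ :=
  iteratedDeriv 4 b x
    - 2 * (β ^ 2 - α ^ 2) * (iteratedDeriv 2 b x + 3 * μ * b x ^ 2 + b x ^ 3)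
    + (α ^ 2 + β ^ 2) ^ 2 * b x
    + 5 * b x * deriv b x ^ 2
    + 5 * b x ^ 2 * iteratedDeriv 2 b x
    + 3 / 2 * b x ^ 5
    + 5 * μ * deriv b x ^ 2
    + 10 * μ * b x * iteratedDeriv 2 b x
    + 10 * μ ^ 2 * b x ^ 3
    + 15 / 2 * μ * b x ^ 4

end

/-!
Write `τ = F + iG` and let `ℓ + iθ = τ'/τ` be its logarithmic derivative in `x`, so that the breather
is `B = 2√2 θ`. With `m = √2 μ` and Hirota's bilinear derivatives `D`, two quadratic relations hold
(`expTrig_bilinear_two`, `expTrig_bilinear_five`):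
* `D² τ·τ̄ = -im D τ·τ̄`, which says `ℓ' = 2θ² + mθ`;
* `D⁵ G·F + (5m/4) D⁴ (F·F + G·G) - (5m²/2 + 2(β² - α²)) D³ G·F + (α² + β²)² D G·F = 0`.

Both are finite computations: `F` and `G` are linear combinations of `e^{±β y₂}`, `cos (α y₁)` and
`sin (α y₁)`, hence so are their derivatives (`expTrig`, `expTrigDeriv`). Divided by `|τ|²`, each
Hirota derivative of `τ` and `τ̄` is a polynomial in `θ, θ', …, ℓ', ℓ'', …`; if `ℓ'` is eliminated by
the first relation, the left side of the second becomes exactly `J_μ[B] / (2√2)`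
(`stationary_of_bilinear`).

Division by `|τ|² = F² + G²` is legitimate since `F` and `G` have no common zero (`no_common_zero`).
It also gives smoothness: at every point, whichever branch of the angle defines the breather,
`B = 2√2 (G' F - G F') / (F² + G²)` (`angle_deriv_eq`).
-/

/-! ### Exponential-trigonometric combinations -/

/-- The combination `v₀ e^{b(x+η)} + v₁ e^{-b(x+η)} + v₂ cos (a(x+ξ)) + v₃ sin (a(x+ξ))`, encoded by
its vector `v` of coefficients. -/
noncomputable def expTrig (a b η ξ : ℝ) (v : Fin 4 → ℝ) (x : ℝ) : ℝ :=
  v 0 * Real.exp (b * (x + η)) + v 1 * Real.exp (-(b * (x + η)))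
    + v 2 * Real.cos (a * (x + ξ)) + v 3 * Real.sin (a * (x + ξ))

/-- The action of `d/dx` on the coefficient vectors of `expTrig`. -/
def expTrigDeriv (a b : ℝ) (v : Fin 4 → ℝ) : Fin 4 → ℝ :=
  ![b * v 0, -(b * v 1), a * v 3, -(a * v 2)]

theorem hasDerivAt_expTrig (a b η ξ : ℝ) (v : Fin 4 → ℝ) (x : ℝ) :
    HasDerivAt (expTrig a b η ξ v) (expTrig a b η ξ (expTrigDeriv a b v) x) x := by
  have hb : HasDerivAt (fun x : ℝ => b * (x + η)) b x := by
    simpa using ((hasDerivAt_id x).add_const η).const_mul b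
  have ha : HasDerivAt (fun x : ℝ => a * (x + ξ)) a x := by
    simpa using ((hasDerivAt_id x).add_const ξ).const_mul a
  refine ((((hb.exp.const_mul (v 0)).fun_add (hb.fun_neg.exp.const_mul (v 1))).fun_add
    (ha.cos.const_mul (v 2))).fun_add (ha.sin.const_mul (v 3))).congr_deriv ?_
  simp [expTrig, expTrigDeriv]
  ring

theorem contDiff_expTrig (a b η ξ : ℝ) (v : Fin 4 → ℝ) {n : WithTop ℕ∞} :
    ContDiff ℝ n (expTrig a b η ξ v) := by
  unfold expTrig
  fun_prop

theorem hasDerivAt_expTrig_iterate (a b η ξ : ℝ) (v : Fin 4 → ℝ) (k : ℕ) (x : ℝ) :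
    HasDerivAt (expTrig a b η ξ ((expTrigDeriv a b)^[k] v))
      (expTrig a b η ξ ((expTrigDeriv a b)^[k + 1] v) x) x := by
  rw [Function.iterate_succ_apply']
  exact hasDerivAt_expTrig ..

/-! ### Bilinear relations and absence of common zeros -/

/-- The coefficients of `2 a r d² F` as an `expTrig`, where `F` is `gardnerF` and `m = √2 μ`,
`r = √(a² + b²)`, `d = √Δ`. The factor `2 a r d²` clears all denominators; it does not affect the
angle of `F + iG`. -/
def gardnerFCoeff (a b m r d : ℝ) : Fin 4 → ℝ :=
  ![a * r * d ^ 2, a * r * d ^ 2, -(2 * m * b * d * a), 2 * m * b ^ 2 * d]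

/-- The coefficients of `2 a r d² G` as an `expTrig`, with the normalization of
`gardnerFCoeff`; `cosh + sinh` contributes only to `e^{b y₂}`. -/
def gardnerGCoeff (a b m r d : ℝ) : Fin 4 → ℝ :=
  ![-(2 * m * b * a * r), 0, 0, 2 * b * r ^ 2 * d]

/-- `F` and `G` cannot vanish together: with `e = e^{b y₂}`, `f = e^{-b y₂}`, `F = G = 0`
determines `m b s` and `m b c` for `s = sin (a y₁)`, `c = cos (a y₁)`, and their squares add up to
more than `m² b²`. -/
theorem no_common_zero {a b m r d e f s c : ℝ} (ha : a ≠ 0) (hb : b ≠ 0) (hr : 0 < r)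
    (hd : 0 < d) (hr2 : r ^ 2 = a ^ 2 + b ^ 2) (he : 0 < e) (hef : e * f = 1)
    (hsc : s ^ 2 + c ^ 2 = 1)
    (hF : a * r * d ^ 2 * (e + f) = 2 * m * b * d * (a * c - b * s))
    (hG : 2 * b * r ^ 2 * d * s = 2 * m * b * a * r * e) : False := by
  have hs : r * d * s = m * a * e := by
    have : 2 * b * r ≠ 0 := by positivity
    exact mul_left_cancel₀ this (by linear_combination hG)
  have hc : 2 * m * b * (r * d * c) = r ^ 2 * d ^ 2 * (e + f) + 2 * m ^ 2 * b ^ 2 * e := by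
    have : a * d ≠ 0 := by positivity
    exact mul_left_cancel₀ this (by linear_combination (-r * d) * hF + 2 * m * b ^ 2 * d * hs)
  have key : r ^ 4 * d ^ 4 * (e + f) ^ 2
      + 4 * m ^ 2 * b ^ 2 * (r ^ 2 * d ^ 2 * e ^ 2 + m ^ 2 * r ^ 2 * e ^ 2) = 0 := by
    have hs2 := congrArg (· ^ 2) hs
    have hc2 := congrArg (· ^ 2) hc
    linear_combination -4 * m ^ 2 * b ^ 2 * hs2 - hc2 + 4 * m ^ 2 * b ^ 2 * r ^ 2 * d ^ 2 * hsc
      - 4 * m ^ 2 * b ^ 2 * r ^ 2 * d ^ 2 * hef + 4 * m ^ 4 * b ^ 2 * e ^ 2 * hr2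
  have hf : 0 < f := by
    by_contra hf
    nlinarith
  have : 0 < r ^ 4 * d ^ 4 * (e + f) ^ 2 := by positivity
  have : 0 ≤ 4 * m ^ 2 * b ^ 2 * (r ^ 2 * d ^ 2 * e ^ 2 + m ^ 2 * r ^ 2 * e ^ 2) := by positivity
  linarith

/-- The bilinear relation `D² τ·τ̄ = -im D τ·τ̄` for `τ = F + iG`, with `D` the Hirota derivative. -/
theorem expTrig_bilinear_two {a b m r d : ℝ} (η ξ : ℝ) (hr : r ^ 2 = a ^ 2 + b ^ 2)
    (hd : d ^ 2 = r ^ 2 - m ^ 2) (x : ℝ) {F G : ℕ → ℝ}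
    (hF : ∀ k, F k = expTrig a b η ξ ((expTrigDeriv a b)^[k] (gardnerFCoeff a b m r d)) x)
    (hG : ∀ k, G k = expTrig a b η ξ ((expTrigDeriv a b)^[k] (gardnerGCoeff a b m r d)) x) :
    F 0 * F 2 - F 1 ^ 2 + G 0 * G 2 - G 1 ^ 2 = m * (G 1 * F 0 - G 0 * F 1) := by
  simp only [hF, hG, expTrig, expTrigDeriv, gardnerFCoeff, gardnerGCoeff, Function.iterate_succ,
    Function.iterate_zero, Function.comp_apply, id_eq, Matrix.cons_val]
  have hef : Real.exp (b * (x + η)) * Real.exp (-(b * (x + η))) = 1 := by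
    rw [← Real.exp_add, add_neg_cancel, Real.exp_zero]
  have hsc := Real.sin_sq_add_cos_sq (a * (x + ξ))
  generalize Real.exp (b * (x + η)) = e, Real.exp (-(b * (x + η))) = f,
    Real.sin (a * (x + ξ)) = s, Real.cos (a * (x + ξ)) = c at *
  grind

/-- The fifth-order bilinear relation
`D⁵ G·F + (5m/4) D⁴ (F·F + G·G) - (5m²/2 + 2(b² - a²)) D³ G·F + (a² + b²)² D G·F = 0`, with `D` the
Hirota derivative. -/
theorem expTrig_bilinear_five {a b m r d : ℝ} (η ξ : ℝ) (hr : r ^ 2 = a ^ 2 + b ^ 2)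
    (hd : d ^ 2 = r ^ 2 - m ^ 2) (x : ℝ) {F G : ℕ → ℝ}
    (hF : ∀ k, F k = expTrig a b η ξ ((expTrigDeriv a b)^[k] (gardnerFCoeff a b m r d)) x)
    (hG : ∀ k, G k = expTrig a b η ξ ((expTrigDeriv a b)^[k] (gardnerGCoeff a b m r d)) x) :
    (G 5 * F 0 - 5 * G 4 * F 1 + 10 * G 3 * F 2 - 10 * G 2 * F 3 + 5 * G 1 * F 4 - G 0 * F 5)
      + 5 * m / 2 * (F 0 * F 4 - 4 * F 1 * F 3 + 3 * F 2 ^ 2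
        + G 0 * G 4 - 4 * G 1 * G 3 + 3 * G 2 ^ 2)
      - (5 / 2 * m ^ 2 + 2 * (b ^ 2 - a ^ 2))
        * (G 3 * F 0 - 3 * G 2 * F 1 + 3 * G 1 * F 2 - G 0 * F 3)
      + (a ^ 2 + b ^ 2) ^ 2 * (G 1 * F 0 - G 0 * F 1) = 0 := by
  simp only [hF, hG, expTrig, expTrigDeriv, gardnerFCoeff, gardnerGCoeff, Function.iterate_succ,
    Function.iterate_zero, Function.comp_apply, id_eq, Matrix.cons_val]
  have hef : Real.exp (b * (x + η)) * Real.exp (-(b * (x + η))) = 1 := by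
    rw [← Real.exp_add, add_neg_cancel, Real.exp_zero]
  have hsc := Real.sin_sq_add_cos_sq (a * (x + ξ))
  generalize Real.exp (b * (x + η)) = e, Real.exp (-(b * (x + η))) = f,
    Real.sin (a * (x + ξ)) = s, Real.cos (a * (x + ξ)) = c at *
  grind

/-! ### From bilinear relations to the stationary equation -/

/-- If `τ' = (ℓ + iθ) τ` and `τ₁ = (P + iQ) τ`, where `τ = F₀ + iG₀` and `τ₁ = F₁ + iG₁`, then
`τ₁' = (P' + iQ' + (ℓ + iθ)(P + iQ)) τ`, here in real and imaginary parts. -/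
theorem logDeriv_step {F₀ G₀ F₁ G₁ F₂ G₂ P Q P' Q' ℓ θ : ℝ → ℝ}
    (hF₀ : ∀ x, HasDerivAt F₀ (ℓ x * F₀ x - θ x * G₀ x) x)
    (hG₀ : ∀ x, HasDerivAt G₀ (θ x * F₀ x + ℓ x * G₀ x) x)
    (hP : ∀ x, HasDerivAt P (P' x) x) (hQ : ∀ x, HasDerivAt Q (Q' x) x)
    (hF : ∀ x, HasDerivAt F₁ (F₂ x) x) (hG : ∀ x, HasDerivAt G₁ (G₂ x) x)
    (eF : ∀ x, F₁ x = P x * F₀ x - Q x * G₀ x) (eG : ∀ x, G₁ x = Q x * F₀ x + P x * G₀ x) :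
    (∀ x, F₂ x = (P' x + ℓ x * P x - θ x * Q x) * F₀ x - (Q' x + ℓ x * Q x + θ x * P x) * G₀ x) ∧
    (∀ x, G₂ x = (Q' x + ℓ x * Q x + θ x * P x) * F₀ x + (P' x + ℓ x * P x - θ x * Q x) * G₀ x) := by
  obtain rfl : F₁ = fun x => P x * F₀ x - Q x * G₀ x := funext eF
  obtain rfl : G₁ = fun x => Q x * F₀ x + P x * G₀ x := funext eG
  refine ⟨fun x => ?_, fun x => ?_⟩
  · rw [(hF x).unique (((hP x).fun_mul (hF₀ x)).fun_sub ((hQ x).fun_mul (hG₀ x)))]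
    ring
  · rw [(hG x).unique (((hQ x).fun_mul (hF₀ x)).fun_add ((hP x).fun_mul (hG₀ x)))]
    ring

/-- The two bilinear relations for `τ = F + iG` imply the stationary equation for the derivative
`θ` of the angle of `τ`. The index of `F`, `G`, `θ` counts derivatives. The conclusion is
`J_μ[B] / (2√2) = 0` for `B = 2√2 θ` and `m = √2 μ`. -/
theorem stationary_of_bilinear {F G : ℕ → ℝ → ℝ} {m a b : ℝ} {θ : ℕ → ℝ → ℝ}
    (hF : ∀ k x, HasDerivAt (F k) (F (k + 1) x) x)
    (hG : ∀ k x, HasDerivAt (G k) (G (k + 1) x) x)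
    (hθ : ∀ k x, HasDerivAt (θ k) (θ (k + 1) x) x)
    (hpos : ∀ x, 0 < F 0 x ^ 2 + G 0 x ^ 2)
    (hθ₀ : ∀ x, θ 0 x = (G 1 x * F 0 x - G 0 x * F 1 x) / (F 0 x ^ 2 + G 0 x ^ 2))
    (h₂ : ∀ x, F 0 x * F 2 x - F 1 x ^ 2 + G 0 x * G 2 x - G 1 x ^ 2
      = m * (G 1 x * F 0 x - G 0 x * F 1 x))
    (h₅ : ∀ x, (G 5 x * F 0 x - 5 * G 4 x * F 1 x + 10 * G 3 x * F 2 x - 10 * G 2 x * F 3 x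
        + 5 * G 1 x * F 4 x - G 0 x * F 5 x)
      + 5 * m / 2 * (F 0 x * F 4 x - 4 * F 1 x * F 3 x + 3 * F 2 x ^ 2
        + G 0 x * G 4 x - 4 * G 1 x * G 3 x + 3 * G 2 x ^ 2)
      - (5 / 2 * m ^ 2 + 2 * (b ^ 2 - a ^ 2))
        * (G 3 x * F 0 x - 3 * G 2 x * F 1 x + 3 * G 1 x * F 2 x - G 0 x * F 3 x)
      + (a ^ 2 + b ^ 2) ^ 2 * (G 1 x * F 0 x - G 0 x * F 1 x) = 0) (x : ℝ) :
    θ 4 x - 2 * (b ^ 2 - a ^ 2) * (θ 2 x + 6 * m * θ 0 x ^ 2 + 8 * θ 0 x ^ 3)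
      + (a ^ 2 + b ^ 2) ^ 2 * θ 0 x + 40 * θ 0 x * θ 1 x ^ 2 + 40 * θ 0 x ^ 2 * θ 2 x
      + 96 * θ 0 x ^ 5 + 10 * m * θ 1 x ^ 2 + 20 * m * θ 0 x * θ 2 x + 40 * m ^ 2 * θ 0 x ^ 3
      + 120 * m * θ 0 x ^ 4 = 0 := by
  have hne : ∀ x, F 0 x ^ 2 + G 0 x ^ 2 ≠ 0 := fun x => (hpos x).ne'
  obtain ⟨ℓ, hℓ⟩ : ∃ ℓ : ℝ → ℝ, ℓ = fun x =>
    (F 0 x * F 1 x + G 0 x * G 1 x) / (F 0 x ^ 2 + G 0 x ^ 2) := ⟨_, rfl⟩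
  -- `τ' = (ℓ + iθ) τ`, so every derivative of `τ` is a polynomial in `ℓ, θ, θ', …` times `τ`, once
  -- the relation `h₂`, which says `ℓ' = 2θ² + mθ`, removes the derivatives of `ℓ`.
  have eF₁ : ∀ x, F 1 x = ℓ x * F 0 x - θ 0 x * G 0 x := by
    intro x
    have := hne x
    rw [hθ₀, hℓ]
    field_simp
    ring
  have eG₁ : ∀ x, G 1 x = θ 0 x * F 0 x + ℓ x * G 0 x := by
    intro x
    have := hne x
    rw [hθ₀, hℓ]
    field_simp
    ring
  have hF₀ : ∀ x, HasDerivAt (F 0) (ℓ x * F 0 x - θ 0 x * G 0 x) x := fun x => eF₁ x ▸ hF 0 x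
  have hG₀ : ∀ x, HasDerivAt (G 0) (θ 0 x * F 0 x + ℓ x * G 0 x) x := fun x => eG₁ x ▸ hG 0 x
  have dℓ : ∀ x, HasDerivAt ℓ (2 * θ 0 x ^ 2 + m * θ 0 x) x := by
    intro x
    have hq := (((hF 0 x).fun_mul (hF 1 x)).fun_add ((hG 0 x).fun_mul (hG 1 x))).fun_div
      (((hF 0 x).fun_pow 2).fun_add ((hG 0 x).fun_pow 2)) (hne x)
    rw [hℓ]
    refine hq.congr_deriv ?_
    have h2 := h₂ x
    have := hne x
    have e : F 0 x * F 2 x + G 0 x * G 2 x = F 1 x ^ 2 + G 1 x ^ 2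
      + m * (G 1 x * F 0 x - G 0 x * F 1 x) := by linear_combination h2
    rw [div_eq_iff (pow_ne_zero 2 this)]
    simp only [eF₁ x, eG₁ x] at e ⊢
    norm_num
    linear_combination (F 0 x ^ 2 + G 0 x ^ 2) * e
  obtain ⟨eF₂, eG₂⟩ := logDeriv_step hF₀ hG₀ dℓ (hθ 0) (hF 1) (hG 1) eF₁ eG₁
  have dP₂ : ∀ x, HasDerivAt (fun x => θ 0 x ^ 2 + m * θ 0 x + ℓ x ^ 2) _ x := fun x =>
    (((hθ 0 x).fun_pow 2).fun_add ((hθ 0 x).const_mul m)).fun_add ((dℓ x).fun_pow 2)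
  have dQ₂ : ∀ x, HasDerivAt (fun x => θ 1 x + 2 * (ℓ x * θ 0 x)) _ x := fun x =>
    (hθ 1 x).fun_add (((dℓ x).fun_mul (hθ 0 x)).const_mul 2)
  obtain ⟨eF₃, eG₃⟩ := logDeriv_step hF₀ hG₀ dP₂ dQ₂ (hF 2) (hG 2)
    (fun x => by rw [eF₂]; ring) (fun x => by rw [eG₂]; ring)
  have dP₃ : ∀ x, HasDerivAt (fun x => θ 0 x * θ 1 x + m * θ 1 x + 3 * (ℓ x * θ 0 x ^ 2)
      + 3 * m * (ℓ x * θ 0 x) + ℓ x ^ 3) _ x := fun x =>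
    (((((hθ 0 x).fun_mul (hθ 1 x)).fun_add ((hθ 1 x).const_mul m)).fun_add
      (((dℓ x).fun_mul ((hθ 0 x).fun_pow 2)).const_mul 3)).fun_add
      (((dℓ x).fun_mul (hθ 0 x)).const_mul (3 * m))).fun_add ((dℓ x).fun_pow 3)
  have dQ₃ : ∀ x, HasDerivAt (fun x => θ 2 x + 3 * (ℓ x * θ 1 x) + 5 * θ 0 x ^ 3
      + 3 * m * θ 0 x ^ 2 + 3 * (ℓ x ^ 2 * θ 0 x)) _ x := fun x =>
    ((((hθ 2 x).fun_add (((dℓ x).fun_mul (hθ 1 x)).const_mul 3)).fun_add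
      (((hθ 0 x).fun_pow 3).const_mul 5)).fun_add
      (((hθ 0 x).fun_pow 2).const_mul (3 * m))).fun_add
      ((((dℓ x).fun_pow 2).fun_mul (hθ 0 x)).const_mul 3)
  obtain ⟨eF₄, eG₄⟩ := logDeriv_step hF₀ hG₀ dP₃ dQ₃ (hF 3) (hG 3)
    (fun x => by rw [eF₃]; norm_num; ring) (fun x => by rw [eG₃]; norm_num; ring)
  have dP₄ : ∀ x, HasDerivAt (fun x => θ 1 x ^ 2 + m * θ 2 x + θ 0 x ^ 4 + 6 * m * θ 0 x ^ 3
      + 4 * (ℓ x * (θ 0 x * θ 1 x)) + 3 * m ^ 2 * θ 0 x ^ 2 + 4 * m * (ℓ x * θ 1 x)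
      + 6 * (ℓ x ^ 2 * θ 0 x ^ 2) + 6 * m * (ℓ x ^ 2 * θ 0 x) + ℓ x ^ 4) _ x := fun x =>
    (((((((((((hθ 1 x).fun_pow 2).fun_add ((hθ 2 x).const_mul m)).fun_add
      ((hθ 0 x).fun_pow 4)).fun_add (((hθ 0 x).fun_pow 3).const_mul (6 * m))).fun_add
      (((dℓ x).fun_mul ((hθ 0 x).fun_mul (hθ 1 x))).const_mul 4)).fun_add
      (((hθ 0 x).fun_pow 2).const_mul (3 * m ^ 2))).fun_add
      (((dℓ x).fun_mul (hθ 1 x)).const_mul (4 * m))).fun_add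
      ((((dℓ x).fun_pow 2).fun_mul ((hθ 0 x).fun_pow 2)).const_mul 6)).fun_add
      ((((dℓ x).fun_pow 2).fun_mul (hθ 0 x)).const_mul (6 * m))).fun_add ((dℓ x).fun_pow 4))
  have dQ₄ : ∀ x, HasDerivAt (fun x => θ 3 x + 22 * (θ 0 x ^ 2 * θ 1 x)
      + 10 * m * (θ 0 x * θ 1 x) + 4 * (ℓ x * θ 2 x) + 20 * (ℓ x * θ 0 x ^ 3)
      + 12 * m * (ℓ x * θ 0 x ^ 2) + 6 * (ℓ x ^ 2 * θ 1 x) + 4 * (ℓ x ^ 3 * θ 0 x)) _ x := fun x =>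
    (((((((hθ 3 x).fun_add ((((hθ 0 x).fun_pow 2).fun_mul (hθ 1 x)).const_mul 22)).fun_add
      (((hθ 0 x).fun_mul (hθ 1 x)).const_mul (10 * m))).fun_add
      (((dℓ x).fun_mul (hθ 2 x)).const_mul 4)).fun_add
      (((dℓ x).fun_mul ((hθ 0 x).fun_pow 3)).const_mul 20)).fun_add
      (((dℓ x).fun_mul ((hθ 0 x).fun_pow 2)).const_mul (12 * m))).fun_add
      ((((dℓ x).fun_pow 2).fun_mul (hθ 1 x)).const_mul 6)).fun_add
      ((((dℓ x).fun_pow 3).fun_mul (hθ 0 x)).const_mul 4)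
  obtain ⟨eF₅, eG₅⟩ := logDeriv_step hF₀ hG₀ dP₄ dQ₄ (hF 4) (hG 4)
    (fun x => by rw [eF₄]; norm_num; ring) (fun x => by rw [eG₄]; norm_num; ring)
  -- After substitution `h₅` is `F² + G²` times the claim; all terms with `ℓ` cancel, as Hirota
  -- derivatives of `τ·τ̄` are unchanged, up to a factor, if `τ` is multiplied by a real function.
  have h := h₅ x
  norm_num at eF₂ eG₂ eF₃ eG₃ eF₄ eG₄ eF₅ eG₅
  rw [eF₁, eG₁, eF₂, eG₂, eF₃, eG₃, eF₄, eG₄, eF₅, eG₅] at h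
  refine (mul_eq_zero.mp ?_).resolve_left (hne x)
  linear_combination h

/-! ### The breather as a logarithmic derivative -/

open Classical in
/-- Both branches of the angle of `f + ig` have the derivative `(g' f - g f') / (f² + g²)`. -/
theorem angle_deriv_eq {f g : ℝ → ℝ} {f' g' x : ℝ} (hf : HasDerivAt f f' x)
    (hg : HasDerivAt g g' x) (h : 0 < f x ^ 2 + g x ^ 2) :
    (if f x ≠ 0 then deriv (fun s => Real.arctan (g s / f s)) x
      else deriv (fun s => -Real.arctan (f s / g s)) x)
      = (g' * f x - g x * f') / (f x ^ 2 + g x ^ 2) := by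
  have hne := h.ne'
  split_ifs with h0
  · rw [(hg.fun_div hf h0).arctan.deriv]
    have : 1 + (g x / f x) ^ 2 ≠ 0 := by positivity
    field_simp
  · have hf0 : f x = 0 := by simpa using h0
    have hg0 : g x ≠ 0 := by
      rintro hg0
      simp [hf0, hg0] at h
    rw [(hf.fun_div hg hg0).arctan.fun_neg.deriv]
    simp only [hf0]
    field_simp
    ring

theorem gardner_eq_expTrig {α β μ x₁ x₂ t m r d η ξ : ℝ} (hα : α ≠ 0) (hr : 0 < r) (hd : 0 < d)
    (hm : m = √2 * μ) (hrdef : r = √(α ^ 2 + β ^ 2)) (hddef : d = √(gardnerDelta α β μ))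
    (hd2 : d ^ 2 = gardnerDelta α β μ)
    (hη : η = (3 * α ^ 2 - β ^ 2) * t + x₂) (hξ : ξ = (α ^ 2 - 3 * β ^ 2) * t + x₁) :
    (gardnerF α β μ x₁ x₂ t = fun x => (2 * α * r * d ^ 2)⁻¹
      * expTrig α β η ξ (gardnerFCoeff α β m r d) x) ∧
    (gardnerG α β μ x₁ x₂ t = fun x => (2 * α * r * d ^ 2)⁻¹
      * expTrig α β η ξ (gardnerGCoeff α β m r d) x) := by
  refine ⟨funext fun x => ?_, funext fun x => ?_⟩
  · have e₁ : gardnerY1 α β x₁ t x = x + ξ := by rw [hξ, gardnerY1, add_assoc]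
    have e₂ : gardnerY2 α β x₂ t x = x + η := by rw [hη, gardnerY2, add_assoc]
    rw [gardnerF, e₁, e₂, ← hrdef, ← hddef, ← hm, Real.cosh_eq]
    simp only [expTrig, gardnerFCoeff, Matrix.cons_val]
    field_simp
    ring
  · have e₁ : gardnerY1 α β x₁ t x = x + ξ := by rw [hξ, gardnerY1, add_assoc]
    have e₂ : gardnerY2 α β x₂ t x = x + η := by rw [hη, gardnerY2, add_assoc]
    rw [gardnerG, e₁, e₂, Real.cosh_add_sinh, ← hrdef, ← hddef, ← hm, ← hd2]
    simp only [expTrig, gardnerGCoeff, Matrix.cons_val]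
    field_simp
    ring

theorem hasDerivAt_iteratedDeriv {f : ℝ → ℝ} (hf : ContDiff ℝ (⊤ : ℕ∞) f) (k : ℕ) (x : ℝ) :
    HasDerivAt (iteratedDeriv k f) (iteratedDeriv (k + 1) f x) x := by
  rw [iteratedDeriv_succ]
  exact (hf.differentiable_iteratedDeriv k (mod_cast ENat.natCast_lt_top k) x).hasDerivAt

open scoped ContDiff in
theorem theorem3p2 (α β μ x₁ x₂ : ℝ) (hα : α ≠ 0) (hβ : β ≠ 0) (hμ : μ ≠ 0)
    (hΔ : 0 < α ^ 2 + β ^ 2 - 2 * μ ^ 2) (t : ℝ) :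
    (∀ x : ℝ, 0 < gardnerF α β μ x₁ x₂ t x ^ 2 + gardnerG α β μ x₁ x₂ t x ^ 2) ∧
    ContDiff ℝ ∞ (fun x : ℝ => gardnerBreather α β μ x₁ x₂ t x) ∧
    ∀ x : ℝ, gardnerJ α β μ (fun s : ℝ => gardnerBreather α β μ x₁ x₂ t s) x = 0 := by
  have h2 : √2 ^ 2 = 2 := Real.sq_sqrt (by norm_num)
  obtain ⟨r, hrdef⟩ : ∃ r, r = √(α ^ 2 + β ^ 2) := ⟨_, rfl⟩
  obtain ⟨d, hddef⟩ : ∃ d, d = √(gardnerDelta α β μ) := ⟨_, rfl⟩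
  obtain ⟨m, hm⟩ : ∃ m, m = √2 * μ := ⟨_, rfl⟩
  obtain ⟨η, hη⟩ : ∃ η, η = (3 * α ^ 2 - β ^ 2) * t + x₂ := ⟨_, rfl⟩
  obtain ⟨ξ, hξ⟩ : ∃ ξ, ξ = (α ^ 2 - 3 * β ^ 2) * t + x₁ := ⟨_, rfl⟩
  have hr : 0 < r := by rw [hrdef]; positivity
  have hd : 0 < d := by rw [hddef]; exact Real.sqrt_pos.mpr hΔ
  have hr2 : r ^ 2 = α ^ 2 + β ^ 2 := by rw [hrdef]; exact Real.sq_sqrt (by positivity)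
  have hdΔ : d ^ 2 = gardnerDelta α β μ := by rw [hddef]; exact Real.sq_sqrt hΔ.le
  have hd2 : d ^ 2 = r ^ 2 - m ^ 2 := by
    rw [hdΔ, gardnerDelta, hr2, hm, mul_pow, h2]
  obtain ⟨eF, eG⟩ := gardner_eq_expTrig (x₁ := x₁) (x₂ := x₂) hα hr hd hm hrdef hddef hdΔ hη hξ
  have hN : (2 * α * r * d ^ 2)⁻¹ ≠ 0 := by positivity
  generalize (2 * α * r * d ^ 2)⁻¹ = N at eF eG hN
  obtain ⟨F, hF⟩ : ∃ F : ℕ → ℝ → ℝ, ∀ k, F k =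
    expTrig α β η ξ ((expTrigDeriv α β)^[k] (gardnerFCoeff α β m r d)) := ⟨_, fun _ => rfl⟩
  obtain ⟨G, hG⟩ : ∃ G : ℕ → ℝ → ℝ, ∀ k, G k =
    expTrig α β η ξ ((expTrigDeriv α β)^[k] (gardnerGCoeff α β m r d)) := ⟨_, fun _ => rfl⟩
  have dF : ∀ k x, HasDerivAt (F k) (F (k + 1) x) x := fun k x => by
    rw [hF, hF]
    exact hasDerivAt_expTrig_iterate ..
  have dG : ∀ k x, HasDerivAt (G k) (G (k + 1) x) x := fun k x => by
    rw [hG, hG]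
    exact hasDerivAt_expTrig_iterate ..
  replace eF : gardnerF α β μ x₁ x₂ t = fun x => N * F 0 x := by rw [hF]; exact eF
  replace eG : gardnerG α β μ x₁ x₂ t = fun x => N * G 0 x := by rw [hG]; exact eG
  have hpos : ∀ x, 0 < F 0 x ^ 2 + G 0 x ^ 2 := by
    intro x
    by_contra hneg
    have hF0 : F 0 x = 0 := by nlinarith [sq_nonneg (F 0 x), sq_nonneg (G 0 x)]
    have hG0 : G 0 x = 0 := by nlinarith [sq_nonneg (F 0 x), sq_nonneg (G 0 x)]
    simp only [hF, hG, Function.iterate_zero, id_eq, expTrig, gardnerFCoeff, gardnerGCoeff,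
      Matrix.cons_val] at hF0 hG0
    refine no_common_zero (m := m) hα hβ hr hd hr2 (Real.exp_pos (β * (x + η)))
      (f := Real.exp (-(β * (x + η)))) ?_ (Real.sin_sq_add_cos_sq (α * (x + ξ))) ?_ ?_
    · rw [← Real.exp_add, add_neg_cancel, Real.exp_zero]
    · linear_combination hF0
    · linear_combination hG0
  have hpos' : ∀ x, 0 < gardnerF α β μ x₁ x₂ t x ^ 2 + gardnerG α β μ x₁ x₂ t x ^ 2 := by
    intro x
    rw [eF, eG]
    have := hpos x
    have : 0 < N ^ 2 * (F 0 x ^ 2 + G 0 x ^ 2) := by positivity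
    linarith
  obtain ⟨θ, hθ⟩ : ∃ θ : ℝ → ℝ, θ = fun x =>
    (G 1 x * F 0 x - G 0 x * F 1 x) / (F 0 x ^ 2 + G 0 x ^ 2) := ⟨_, rfl⟩
  have hB : (fun x => gardnerBreather α β μ x₁ x₂ t x) = fun x => 2 * √2 * θ x := by
    funext x
    rw [gardnerBreather, ← mul_ite]
    congr 1
    have hx := hpos' x
    rw [eF, eG] at hx ⊢
    rw [angle_deriv_eq ((dF 0 x).const_mul N) ((dG 0 x).const_mul N) hx, hθ]
    have := (hpos x).ne'
    have := hx.ne'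
    field_simp
  have cF : ∀ k, ContDiff ℝ ∞ (F k) := fun k => by rw [hF]; exact contDiff_expTrig ..
  have cG : ∀ k, ContDiff ℝ ∞ (G k) := fun k => by rw [hG]; exact contDiff_expTrig ..
  have cθ : ContDiff ℝ ∞ θ := by
    rw [hθ]
    exact (((cG 1).mul (cF 0)).sub ((cG 0).mul (cF 1))).div
      (((cF 0).pow 2).add ((cG 0).pow 2)) fun x => (hpos x).ne'
  refine ⟨hpos', ?_, fun x => ?_⟩
  · rw [hB]
    exact contDiff_const.mul cθ
  · have key := stationary_of_bilinear (θ := fun k => iteratedDeriv k θ) dF dG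
      (fun k x => hasDerivAt_iteratedDeriv cθ k x) hpos
      (fun x => by rw [iteratedDeriv_zero, hθ])
      (fun x => expTrig_bilinear_two (F := (F · x)) (G := (G · x)) η ξ hr2 hd2 x
        (fun k => by rw [hF]) (fun k => by rw [hG]))
      (fun x => expTrig_bilinear_five (F := (F · x)) (G := (G · x)) η ξ hr2 hd2 x
        (fun k => by rw [hF]) (fun k => by rw [hG])) x
    simp only [iteratedDeriv_zero, hm] at key
    rw [hB, gardnerJ, ← iteratedDeriv_one]
    simp only [iteratedDeriv_const_mul_field]
    generalize iteratedDeriv 4 θ x = θ₄, iteratedDeriv 2 θ x = θ₂, iteratedDeriv 1 θ x = θ₁,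
      θ x = θ₀ at key ⊢
    generalize √2 = w at *
    have h3 : w ^ 3 = 2 * w := by linear_combination w * h2
    have h4 : w ^ 4 = 4 := by linear_combination (w ^ 2 + 2) * h2
    have h5 : w ^ 5 = 4 * w := by linear_combination (w ^ 3 + 2 * w) * h2
    -- `B = 2√2 θ` turns the claim into `2√2` times `key`, modulo the relations for `w = √2`.
    ring_nf at key ⊢
    grind
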